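/- Formulas are built from countably many propositional variables (among them the distinct variables $p,q,r$) and $\bot$ by $\wedge,\vee,\to$ and coimplication $\leftarrow$; put $\top:=\bot\to\bot$, $\neg\varphi:=\varphi\to\bot$, ${\sim}\varphi:=\varphi\leftarrow\top$. A bi-Heyting algebra is a bounded lattice with operations such that $a\wedge x\le b\iff x\le a\to b$ and $b\le a\vee x\iff (a\leftarrow b)\le x$ for all $a,b,x$; it validates $\varphi$ if $\varphi$ takes the value $\top$ under all valuations. The Heyting--Brouwer calculus $\mathsf{HB}$ is the least set of formulas that contains the intuitionistic propositional calculus $\mathsf{IPC}$ and the axioms $p\to(q\vee(q\leftarrow p))$, $(q\leftarrow p)\to{\sim}(p\to q)$, $(r\leftarrow(q\leftarrow p))\to((q\vee r)\leftarrow p)$, $\neg(q\leftarrow p)\to(p\to q)$, $\neg(p\leftarrow p)$ and is closed under substitution, modus ponens and the rule $\varphi/\neg{\sim}\varphi$. An intermediate HB-logic is a set of formulas that contains $\mathsf{HB}$, is closed under these three rules and does not contain $\bot$. For a set $\Gamma$ of formulas, $\mathsf{HB}+\Gamma$ is the least set that contains $\mathsf{HB}\cup\Gamma$ and is closed under the three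 rules. Let $\beta_0=q\to p$, $\gamma_0=p\to q$, $\beta_1=\gamma_0\to(\beta_0\vee q)$, $\gamma_1=\beta_0\to(\gamma_0\vee p)$, and for $n\ge0$ $$\beta_{n+2}=\gamma_{n+1}\to(\beta_{n+1}\vee\gamma_n),\qquad \gamma_{n+2}=\beta_{n+1}\to(\gamma_{n+1}\vee\beta_n),$$ $$\alpha_n=(\beta_{n+2}\wedge\gamma_{n+2})\to(\beta_{n+1}\vee\gamma_{n+1}),\qquad \delta_n=\alpha_n\vee\alpha_{n+1},\qquad \varkappa_n=\alpha_{n+1}\to(\alpha_n\vee\beta_{n+2}).$$ Let $\mathsf{bb}_2$ be the formula $$[(p\to(q\vee r))\to(q\vee r)]\wedge[(q\to(p\vee r))\to(p\vee r)]\wedge[(r\to(p\vee q))\to(p\vee q)]\ \to\ (p\vee q\vee r),$$ and let $\mathsf{Sh}=\mathsf{HB}+\{(\alpha_0\to\delta_1)\to\delta_0,\ \varkappa_0,\ \mathsf{bb}_2\}$. The Fine frame is the set of distinct points $a_n,b_n,c_n,d_n$ $(n\ge0)$ with the least partial order such that, for all $n$, $b_{n+1}\le b_n$, $c_{n+1}\le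 c_n$, $b_{n+2}\le c_n$, $c_{n+2}\le b_n$, $a_n\le b_{n+1}$, $a_n\le c_{n+1}$, $d_n\le a_n$ and $d_n\le d_{n+1}$. Equip it with the discrete topology, let $X$ be its one-point compactification by a point $\infty$, and extend the order by $d_i\le\infty\le b_i,c_i$ for all $i$. Let $\mathfrak A$ be the bi-Heyting algebra of clopen upsets of $X$ ordered by inclusion, and let $\mathsf F$ be the set of formulas that $\mathfrak A$ validates. For a topological space $Y$ let $\mathsf{Op}(Y)$ be the Heyting algebra of open subsets of $Y$. It is a bi-Heyting algebra if all coimplications exist in it. A set $L$ of formulas is topologically complete if each formula $\varphi\notin L$ is refuted in $\mathsf{Op}(Y)$ for some space $Y$ such that $\mathsf{Op}(Y)$ is a bi-Heyting algebra validating all formulas in $L$. Corollary. No intermediate HB-logic $L$ with $\mathsf{Sh}\subseteq L\subseteq\mathsf F$ is topologically complete. Indeed, for each such $L$, if $Y$ is a topological space for which $\mathsf{Op}(Y)$ is a bi-Heyting algebra validating $L$, then $\mathsf{Op}(Y)$ validates $\delta_0$, while $\delta_0\notin L$. In particular, $\mathsf{Sh}$ is itself an intermediate HB-logic with $\mathsf{Sh}\subseteq\mathsf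 F$; it is finitely axiomatizable over $\mathsf{HB}$ (that is, of the form $\mathsf{HB}+\Gamma$ with $\Gamma$ finite) and it is topologically incomplete. -/

import Mathlib

open TopologicalSpace

namespace HBLogic

/-! ## Formulas of the Heyting-Brouwer language -/

/-- Propositional formulas over the variables `var 0, var 1, …`, with coimplication. -/
inductive Form : Type
  | var : ℕ → Form
  | bot : Form
  | and : Form → Form → Form
  | or : Form → Form → Form
  | imp : Form → Form → Form
  | coimp : Form → Form → Form

infixl:69 " ⋏ " => Form.and
infixl:68 " ⋎ " => Form.or
infixr:60 " ⟶ₕ " => Form.imp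
infix:61 " ⟵ₕ " => Form.coimp

namespace Form

def top : Form := bot ⟶ₕ bot

/-- Intuitionistic negation `¬φ`. -/
def neg (φ : Form) : Form := φ ⟶ₕ bot

/-- Dual (Brouwerian) negation `∼φ`; its value is the least `x` with `φ ∨ x = ⊤`. -/
def dneg (φ : Form) : Form := φ ⟵ₕ top

def subst (σ : ℕ → Form) : Form → Form
  | var n => σ n
  | bot => bot
  | and φ ψ => subst σ φ ⋏ subst σ ψ
  | or φ ψ => subst σ φ ⋎ subst σ ψ
  | imp φ ψ => subst σ φ ⟶ₕ subst σ ψ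
  | coimp φ ψ => subst σ φ ⟵ₕ subst σ ψ

/-- The value of a formula in a bi-Heyting algebra. The coimplication `a ← b` is characterized by
`a ← b ≤ x ↔ b ≤ a ⊔ x`, so it is `b \ a` in Mathlib's notation. -/
def eval {H : Type*} [BiheytingAlgebra H] (v : ℕ → H) : Form → H
  | var n => v n
  | bot => ⊥
  | and φ ψ => eval v φ ⊓ eval v ψ
  | or φ ψ => eval v φ ⊔ eval v ψ
  | imp φ ψ => eval v φ ⇨ eval v ψ
  | coimp φ ψ => eval v ψ \ eval v φ

/-- `H ⊨ φ`. -/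
def Valid (H : Type*) [BiheytingAlgebra H] (φ : Form) : Prop :=
  ∀ v : ℕ → H, φ.eval v = ⊤

end Form

/-! ## The calculus HB and its extensions -/

def p : Form := .var 0
def q : Form := .var 1
def r : Form := .var 2

/-- A standard finite axiomatization of the intuitionistic propositional calculus. -/
def ipcAxioms : Set Form :=
  {p ⟶ₕ (q ⟶ₕ p),
   (p ⟶ₕ (q ⟶ₕ r)) ⟶ₕ ((p ⟶ₕ q) ⟶ₕ (p ⟶ₕ r)),
   (p ⋏ q) ⟶ₕ p,
   (p ⋏ q) ⟶ₕ q,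
   p ⟶ₕ (q ⟶ₕ (p ⋏ q)),
   p ⟶ₕ (p ⋎ q),
   q ⟶ₕ (p ⋎ q),
   (p ⟶ₕ r) ⟶ₕ ((q ⟶ₕ r) ⟶ₕ ((p ⋎ q) ⟶ₕ r)),
   Form.bot ⟶ₕ p}

/-- The axioms for coimplication. -/
def coimpAxioms : Set Form :=
  {p ⟶ₕ (q ⋎ (q ⟵ₕ p)),
   (q ⟵ₕ p) ⟶ₕ (p ⟶ₕ q).dneg,
   (r ⟵ₕ (q ⟵ₕ p)) ⟶ₕ ((q ⋎ r) ⟵ₕ p),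
   (q ⟵ₕ p).neg ⟶ₕ (p ⟶ₕ q),
   (p ⟵ₕ p).neg}

/-- Closure under substitution, modus ponens and the rule `φ / ¬∼φ`. -/
structure ClosedUnderRules (L : Set Form) : Prop where
  subst : ∀ (φ : Form) (σ : ℕ → Form), φ ∈ L → φ.subst σ ∈ L
  mp : ∀ φ ψ : Form, (φ ⟶ₕ ψ) ∈ L → φ ∈ L → ψ ∈ L
  neg_dneg : ∀ φ : Form, φ ∈ L → φ.dneg.neg ∈ L

/-- Derivability from `HB` with additional axioms `Γ`. -/
inductive Derivable (Γ : Set Form) : Form → Prop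
  | ipc {φ : Form} : φ ∈ ipcAxioms → Derivable Γ φ
  | co {φ : Form} : φ ∈ coimpAxioms → Derivable Γ φ
  | ax {φ : Form} : φ ∈ Γ → Derivable Γ φ
  | subst {φ : Form} (σ : ℕ → Form) : Derivable Γ φ → Derivable Γ (φ.subst σ)
  | mp {φ ψ : Form} : Derivable Γ (φ ⟶ₕ ψ) → Derivable Γ φ → Derivable Γ ψ
  | neg_dneg {φ : Form} : Derivable Γ φ → Derivable Γ φ.dneg.neg

/-- `HB + Γ`: the least set of formulas that contains the axioms of `HB` and `Γ` and is closed
under the three rules. -/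
def HBPlus (Γ : Set Form) : Set Form := {φ | Derivable Γ φ}

/-- The Heyting-Brouwer calculus. -/
def HB : Set Form := HBPlus ∅

/-- Intermediate HB-logics. -/
structure IsIntermediateHBLogic (L : Set Form) : Prop where
  HB_subset : HB ⊆ L
  closed : ClosedUnderRules L
  consistent : Form.bot ∉ L

/-- `L` is obtained from `HB` by adding finitely many axioms. -/
def FinitelyAxiomatizable (L : Set Form) : Prop :=
  ∃ Γ : Set Form, Γ.Finite ∧ L = HBPlus Γ

/-! ## The Shehtman logic over HB -/

/-- The pairs `(β n, γ n)`. -/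
def betaGamma : ℕ → Form × Form
  | 0 => (q ⟶ₕ p, p ⟶ₕ q)
  | 1 => ((p ⟶ₕ q) ⟶ₕ ((q ⟶ₕ p) ⋎ q), (q ⟶ₕ p) ⟶ₕ ((p ⟶ₕ q) ⋎ p))
  | n + 2 =>
    ((betaGamma (n + 1)).2 ⟶ₕ ((betaGamma (n + 1)).1 ⋎ (betaGamma n).2),
     (betaGamma (n + 1)).1 ⟶ₕ ((betaGamma (n + 1)).2 ⋎ (betaGamma n).1))

def beta (n : ℕ) : Form := (betaGamma n).1

def gamma (n : ℕ) : Form := (betaGamma n).2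

def alpha (n : ℕ) : Form :=
  (beta (n + 2) ⋏ gamma (n + 2)) ⟶ₕ (beta (n + 1) ⋎ gamma (n + 1))

def delta (n : ℕ) : Form := alpha n ⋎ alpha (n + 1)

def kappa (n : ℕ) : Form := alpha (n + 1) ⟶ₕ (alpha n ⋎ beta (n + 2))

/-- The Gabbay-de Jongh formula `bb₂`. -/
def bb2 : Form :=
  (((p ⟶ₕ (q ⋎ r)) ⟶ₕ (q ⋎ r)) ⋏ ((q ⟶ₕ (p ⋎ r)) ⟶ₕ (p ⋎ r)) ⋏
    ((r ⟶ₕ (p ⋎ q)) ⟶ₕ (p ⋎ q))) ⟶ₕ (p ⋎ q ⋎ r)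

/-- The Shehtman logic over `HB`. -/
def Sh : Set Form :=
  HBPlus {(alpha 0 ⟶ₕ delta 1) ⟶ₕ delta 0, kappa 0, bb2}

/-! ## BH-spaces and their algebras of clopen upsets -/

/-- Esakia spaces: compact, Hausdorff, zero-dimensional (equivalently, under compactness and
Hausdorffness, totally disconnected) spaces with a continuous partial order. -/
class EsakiaSpace (X : Type*) [TopologicalSpace X] [PartialOrder X] : Prop
    extends CompactSpace X, T2Space X, TotallyDisconnectedSpace X where
  isClosed_Ici : ∀ x : X, IsClosed (Set.Ici x)
  isClopen_lowerClosure : ∀ U : Set X, IsClopen U → IsClopen (lowerClosure U : Set X)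

class BHSpace (X : Type*) [TopologicalSpace X] [PartialOrder X] : Prop
    extends EsakiaSpace X where
  isClopen_upperClosure : ∀ U : Set X, IsClopen U → IsClopen (upperClosure U : Set X)

section ClopenUpsets

variable {X : Type*} [TopologicalSpace X] [PartialOrder X] [BHSpace X]

/-- `U → V = X \ ↓(U \ V)`. -/
def clopenHimp (U V : ClopenUpperSet X) : ClopenUpperSet X where
  carrier := (lowerClosure ((U : Set X) \ V) : Set X)ᶜ
  isClopen' := (EsakiaSpace.isClopen_lowerClosure _ (U.isClopen.diff V.isClopen)).compl
  upper' := (lowerClosure ((U : Set X) \ V)).lower.compl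

/-- `V \ U = ↑(V \ U)`, the coimplication `U ← V`. -/
def clopenSdiff (V U : ClopenUpperSet X) : ClopenUpperSet X where
  carrier := (upperClosure ((V : Set X) \ U) : Set X)
  isClopen' := BHSpace.isClopen_upperClosure _ (V.isClopen.diff U.isClopen)
  upper' := (upperClosure ((V : Set X) \ U)).upper

/-- The bi-Heyting algebra of clopen upsets of a BH-space, ordered by inclusion. -/
instance : BiheytingAlgebra (ClopenUpperSet X) where
  himp := clopenHimp
  compl U := clopenHimp U ⊥
  sdiff := clopenSdiff
  hnot U := clopenSdiff ⊤ U
  himp_bot _ := rfl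
  top_sdiff _ := rfl
  le_top _ := le_top
  bot_le _ := bot_le
  le_himp_iff U V W := by
    constructor
    · rintro h x ⟨hU, hV⟩
      by_contra hW
      exact h hU (subset_lowerClosure ⟨hV, hW⟩)
    · rintro h x hU ⟨y, ⟨hV, hW⟩, hxy⟩
      exact hW (h ⟨U.upper hxy hU, hV⟩)
  sdiff_le_iff U V W := by
    constructor
    · intro h x hU
      by_cases hV : x ∈ V
      · exact Or.inl hV
      · exact Or.inr (h (subset_upperClosure ⟨hU, hV⟩))
    · rintro h x ⟨y, ⟨hU, hV⟩, hyx⟩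
      exact W.upper hyx ((h hU).resolve_left hV)

end ClopenUpsets

/-! ## The Fine frame and the Fine logic over HB -/

/-- The points `a n`, `b n`, `c n`, `d n` of the Fine frame. -/
inductive FineFrame : Type
  | a : ℕ → FineFrame
  | b : ℕ → FineFrame
  | c : ℕ → FineFrame
  | d : ℕ → FineFrame

namespace FineFrame

/-- The order of the Fine frame, that is, the reflexive transitive closure of
`b (n+1) ≤ b n`, `c (n+1) ≤ c n`, `b (n+2) ≤ c n`, `c (n+2) ≤ b n`,
`a n ≤ b (n+1)`, `a n ≤ c (n+1)`, `d n ≤ a n`, `d n ≤ d (n+1)`. -/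
def le : FineFrame → FineFrame → Prop
  | b m, b n => n ≤ m
  | c m, c n => n ≤ m
  | b m, c n => n + 2 ≤ m
  | c m, b n => n + 2 ≤ m
  | a m, a n => m = n
  | a m, b n => n ≤ m + 1
  | a m, c n => n ≤ m + 1
  | d m, d n => m ≤ n
  | d m, a n => m ≤ n
  | d _, b _ => True
  | d _, c _ => True
  | a _, d _ => False
  | b _, a _ => False
  | b _, d _ => False
  | c _, a _ => False
  | c _, d _ => False

instance : PartialOrder FineFrame where
  le := le
  le_refl x := by cases x <;> simp [le]
  le_trans x y z := by
    cases x <;> cases y <;> cases z <;> simp only [le] <;> intros <;>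
      first | trivial | omega
  le_antisymm x y := by
    cases x <;> cases y <;> simp only [le, a.injEq, b.injEq, c.injEq, d.injEq] <;> grind

/-- The Fine frame is taken with the discrete topology. -/
instance : TopologicalSpace FineFrame := ⊥

instance : DiscreteTopology FineFrame := ⟨rfl⟩

def index : FineFrame → ℕ
  | a n => n
  | b n => n
  | c n => n
  | d n => n

lemma finite_index_lt (N : ℕ) : {x : FineFrame | x.index < N}.Finite := by
  have h := (((Set.finite_lt_nat N).image a).union ((Set.finite_lt_nat N).image b)).union
    (((Set.finite_lt_nat N).image c).union ((Set.finite_lt_nat N).image d))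
  refine h.subset ?_
  rintro (n | n | n | n) hn <;> simpa [index] using hn

lemma finite_of_index {S : Set FineFrame} (N : ℕ) (h : ∀ x ∈ S, x.index < N) : S.Finite :=
  (finite_index_lt N).subset h

lemma exists_index_bound {S : Set FineFrame} (h : S.Finite) : ∃ N, ∀ x ∈ S, x.index < N := by
  obtain ⟨N, hN⟩ := (h.image index).bddAbove
  exact ⟨N + 1, fun x hx => Nat.lt_succ_of_le (hN ⟨x, hx, rfl⟩)⟩

end FineFrame

/-- The one-point compactification of the Fine frame. -/
abbrev FineSpace : Type := OnePoint FineFrame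

namespace FineSpace

open OnePoint FineFrame

/-- The order of the Fine frame, extended by `d i ≤ ∞ ≤ b i, c i` for all `i`. -/
def le : FineSpace → FineSpace → Prop
  | OnePoint.some x, OnePoint.some y => x ≤ y
  | OnePoint.some (d _), ∞ => True
  | OnePoint.some (a _), ∞ => False
  | OnePoint.some (b _), ∞ => False
  | OnePoint.some (c _), ∞ => False
  | ∞, OnePoint.some (b _) => True
  | ∞, OnePoint.some (c _) => True
  | ∞, OnePoint.some (a _) => False
  | ∞, OnePoint.some (d _) => False
  | ∞, ∞ => True

instance : PartialOrder FineSpace where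
  le := le
  le_refl x := by
    cases x using OnePoint.rec with
    | infty => exact trivial
    | coe x => exact le_refl (α := FineFrame) x
  le_trans x y z := by
    cases x using OnePoint.rec <;> cases y using OnePoint.rec <;> cases z using OnePoint.rec
    · exact fun _ h => h
    · exact fun _ h => h
    · exact fun _ _ => trivial
    · rename_i y z
      revert y z
      rintro (n | n | n | n) (m | m | m | m) h1 h2 <;>
        trivial
    · exact fun h _ => h
    · rename_i x z
      revert x z
      rintro (n | n | n | n) (m | m | m | m) h1 h2 <;>
        trivial
    · rename_i x y
      revert x y
      rintro (n | n | n | n) (m | m | m | m) h1 h2 <;>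
        trivial
    · exact fun h1 h2 => le_trans (α := FineFrame) h1 h2
  le_antisymm x y := by
    cases x using OnePoint.rec <;> cases y using OnePoint.rec
    · exact fun _ _ => rfl
    · rename_i y
      revert y
      rintro (n | n | n | n) h1 h2 <;> first | exact h1.elim | exact h2.elim
    · rename_i x
      revert x
      rintro (n | n | n | n) h1 h2 <;> first | exact h1.elim | exact h2.elim
    · exact fun h1 h2 => congrArg OnePoint.some (le_antisymm (α := FineFrame) h1 h2)

/-- Clopen sets: finite sets without `∞` and cofinite sets containing `∞`. -/
lemma isClopen_iff (U : Set FineSpace) :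
    IsClopen U ↔ (∞ ∉ U ∧ {x : FineFrame | (x : FineSpace) ∈ U}.Finite) ∨
      (∞ ∈ U ∧ {x : FineFrame | (x : FineSpace) ∉ U}.Finite) := by
  by_cases h : ∞ ∈ U
  · have : IsClosed U := by
      rw [OnePoint.isClosed_iff_of_mem h]
      exact isClosed_discrete _
    rw [IsClopen, OnePoint.isOpen_iff_of_mem h]
    simp only [this, true_and, h, not_true, false_and, false_or, isClosed_discrete,
      isCompact_iff_finite]
    rfl
  · have : IsOpen U := by
      rw [OnePoint.isOpen_iff_of_notMem h]
      exact isOpen_discrete _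
    rw [IsClopen, OnePoint.isClosed_iff_of_notMem h]
    simp only [this, and_true, h, not_false_eq_true, true_and, false_and, or_false,
      isClosed_discrete, isCompact_iff_finite]
    rfl

lemma isClopen_of_finite {U : Set FineSpace} (h : ∞ ∉ U) (N : ℕ)
    (hN : ∀ x : FineFrame, (x : FineSpace) ∈ U → x.index < N) : IsClopen U :=
  (isClopen_iff U).2 (Or.inl ⟨h, finite_of_index N hN⟩)

lemma isClopen_of_cofinite {U : Set FineSpace} (h : ∞ ∈ U) (N : ℕ)
    (hN : ∀ x : FineFrame, N ≤ x.index → (x : FineSpace) ∈ U) : IsClopen U :=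
  (isClopen_iff U).2 (Or.inr ⟨h, finite_of_index N fun x hx =>
    lt_of_not_ge fun hle => hx (hN x hle)⟩)

lemma exists_bound_of_isClopen {U : Set FineSpace} (hU : IsClopen U) :
    (∞ ∉ U ∧ ∃ N, ∀ x : FineFrame, (x : FineSpace) ∈ U → x.index < N) ∨
      (∞ ∈ U ∧ ∃ N, ∀ x : FineFrame, N ≤ x.index → (x : FineSpace) ∈ U) := by
  rcases (isClopen_iff U).1 hU with ⟨h, hf⟩ | ⟨h, hf⟩
  · exact Or.inl ⟨h, exists_index_bound hf⟩
  · obtain ⟨N, hN⟩ := exists_index_bound hf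
    refine Or.inr ⟨h, N, fun x hx => ?_⟩
    by_contra hxU
    exact absurd (hN x hxU) (not_lt.2 hx)

/-- The downset of a point `b n` or `c n` contains `∞` and almost all points. -/
lemma isClopen_lower_of_mem {L : Set FineSpace} (hL : IsLowerSet L) (n : ℕ)
    (h : (b n : FineSpace) ∈ L ∨ (c n : FineSpace) ∈ L) : IsClopen L := by
  refine isClopen_of_cofinite (h.elim (hL (a := (b n : FineSpace)) trivial)
    (hL (a := (c n : FineSpace)) trivial)) (n + 2) ?_
  rintro (m | m | m | m) hm <;> simp only [index] at hm <;> rcases h with h | h <;>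
    refine hL ?_ h <;> first | trivial | (change n ≤ (_ : ℕ); omega)

/-- The upset of a point `d n` contains `∞` and almost all points. -/
lemma isClopen_upper_of_mem {L : Set FineSpace} (hL : IsUpperSet L) (n : ℕ)
    (h : (d n : FineSpace) ∈ L) : IsClopen L := by
  refine isClopen_of_cofinite (hL (a := (d n : FineSpace)) trivial h) n ?_
  rintro (m | m | m | m) hm <;> simp only [index] at hm <;>
    refine hL ?_ h <;> trivial

instance : BHSpace FineSpace where
  isClosed_Ici x := by
    by_cases hx : ∞ ∈ Set.Ici x
    · rw [OnePoint.isClosed_iff_of_mem hx]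
      exact isClosed_discrete _
    · cases x using OnePoint.rec with
      | infty => exact absurd (le_refl (∞ : FineSpace)) hx
      | coe x =>
        refine (isClopen_of_finite hx (x.index + 2) fun y hy => ?_).isClosed
        have hxy : FineFrame.le x y := hy
        cases x <;> cases y <;> simp only [FineFrame.le] at hxy <;> simp only [index] <;>
          first | exact (hx trivial).elim | omega
  isClopen_lowerClosure U hU := by
    have hlow : IsLowerSet (lowerClosure U : Set FineSpace) := (lowerClosure U).lower
    by_cases hbc : ∃ n, (b n : FineSpace) ∈ U ∨ (c n : FineSpace) ∈ U
    · obtain ⟨n, hn⟩ := hbc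
      exact isClopen_lower_of_mem hlow n
        (hn.imp (fun h => subset_lowerClosure h) (fun h => subset_lowerClosure h))
    · rcases exists_bound_of_isClopen hU with ⟨h, N, hN⟩ | ⟨h, N, hN⟩
      · have key : ∀ y ∈ U, (∃ n, n < N ∧ y = (a n : FineSpace)) ∨
            ∃ n, n < N ∧ y = (d n : FineSpace) := by
          intro y hy
          cases y using OnePoint.rec with
          | infty => exact absurd hy h
          | coe y =>
            cases y with
            | a n => exact Or.inl ⟨n, hN _ hy, rfl⟩
            | b n => exact absurd ⟨n, Or.inl hy⟩ hbc
            | c n => exact absurd ⟨n, Or.inr hy⟩ hbc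
            | d n => exact Or.inr ⟨n, hN _ hy, rfl⟩
        refine isClopen_of_finite ?_ N ?_
        · rintro ⟨y, hy, hle⟩
          rcases key y hy with ⟨n, _, rfl⟩ | ⟨n, _, rfl⟩ <;> exact hle
        · rintro x ⟨y, hy, hle⟩
          rcases key y hy with ⟨n, hn, rfl⟩ | ⟨n, hn, rfl⟩ <;>
            have h2 : FineFrame.le x _ := hle <;> cases x <;> simp only [FineFrame.le] at h2 <;>
            simp only [index] <;> omega
      · exact absurd ⟨N, Or.inl (hN (b N) le_rfl)⟩ hbc
  isClopen_upperClosure U hU := by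
    have hup : IsUpperSet (upperClosure U : Set FineSpace) := (upperClosure U).upper
    by_cases hd : ∃ n, (d n : FineSpace) ∈ U
    · obtain ⟨n, hn⟩ := hd
      exact isClopen_upper_of_mem hup n (subset_upperClosure hn)
    · rcases exists_bound_of_isClopen hU with ⟨h, N, hN⟩ | ⟨h, N, hN⟩
      · have key : ∀ y ∈ U, ∃ z : FineFrame, y = z ∧ z.index < N ∧ ∀ n, z ≠ d n := by
          intro y hy
          cases y using OnePoint.rec with
          | infty => exact absurd hy h
          | coe y => exact ⟨y, rfl, hN y hy, fun n hn => hd ⟨n, hn ▸ hy⟩⟩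
        refine isClopen_of_finite ?_ (N + 2) ?_
        · rintro ⟨y, hy, hle⟩
          obtain ⟨z, rfl, -, hz⟩ := key y hy
          cases z with
          | d n => exact hz n rfl
          | _ => exact hle
        · rintro x ⟨y, hy, hle⟩
          obtain ⟨z, rfl, hzN, hz⟩ := key y hy
          have h2 : FineFrame.le z x := hle
          cases z with
          | d n => exact absurd rfl (hz n)
          | _ =>
            cases x <;> simp only [FineFrame.le] at h2 <;> simp only [index] at * <;> omega
      · exact absurd ⟨N, hN (d N) le_rfl⟩ hd

end FineSpace

/-- The bi-Heyting algebra of clopen upsets of the compactified Fine frame. -/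
abbrev FineAlgebra : Type := ClopenUpperSet FineSpace

/-- The Fine logic over `HB`. -/
def FineLogic : Set Form := {φ | φ.Valid FineAlgebra}

/-! ## Topological semantics -/

/-- A Heyting algebra is a bi-Heyting algebra: all coimplications `a ← b` exist. -/
def HasCoimplication (H : Type*) [HeytingAlgebra H] : Prop :=
  ∀ a b : H, ∃ c : H, ∀ x : H, c ≤ x ↔ b ≤ a ⊔ x

/-- The (unique) bi-Heyting structure that extends the given Heyting algebra. -/
@[reducible]
noncomputable def HasCoimplication.toBiheyting {H : Type*} [HeytingAlgebra H]
    (h : HasCoimplication H) : BiheytingAlgebra H where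
  sdiff b a := (h a b).choose
  hnot a := (h a ⊤).choose
  sdiff_le_iff b a x := (h a b).choose_spec x
  top_sdiff _ := rfl

/-- `Op(X) ⊨ φ`, where `Op(X)`, the Heyting algebra of open sets, is a bi-Heyting algebra. -/
def OpValid (X : Type*) [TopologicalSpace X] (h : HasCoimplication (Opens X)) (φ : Form) : Prop :=
  @Form.Valid (Opens X) h.toBiheyting φ

/-- `L` is topologically complete: each formula outside `L` is refuted in `Op(X)` for some space
`X` such that `Op(X)` is a bi-Heyting algebra validating `L`. -/
def TopologicallyComplete.{u} (L : Set Form) : Prop :=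
  ∀ φ : Form, φ ∉ L → ∃ (X : Type u) (_ : TopologicalSpace X) (h : HasCoimplication (Opens X)),
    (∀ ψ ∈ L, OpValid X h ψ) ∧ ¬ OpValid X h φ

end HBLogic

universe u

namespace HBLogic

/-! ## Soundness of the calculus -/

section Soundness

variable {H : Type*} [BiheytingAlgebra H]

/-! Two facts combine: every complete bi-Heyting algebra validating `Sh` validates `delta 0`, and
the Fine algebra validates `Sh` but refutes `delta 0`.

For the first, let α n and e n be the values of `alpha n` and `beta (n + 2) ⋏ gamma (n + 2)`. A
substitution shifts the ladder by one (`rung_shift`), so the first two axioms hold at every level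
and give the laws `IsKnotSequence`. These imply e n ≤ α n ⊔ α k for all k ≠ n. Coimplication makes
joins distribute over existing infima, so the α k here may be replaced by an infimum of them. Let m
i be the infimum of the α n with n ≢ i mod 3. The three m i satisfy the premises of `bb2`
(`himp_sup_le`), hence join to ⊤; each lies below α 0 or α 1, so α 0 ⊔ α 1 = ⊤.

For the second, a valuation refuting `alpha 0` must separate the chains b and c at some level n
(`exists_isBase`). Then α j is the complement of the downset of a (n + j) (`mem_knot`), and the
first two axioms become statements about the points a and d. The formula `bb2` holds because
nonempty clopen sets have maximal points and every point except ∞ has at most two covers. Sending p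
and q to {b 0} and {c 0} refutes `delta 0` at d 0, which lies below both a 0 and a 1. -/

lemma Form.eval_top (v : ℕ → H) : Form.top.eval v = ⊤ := by
  simp [Form.top, Form.eval]

lemma Form.eval_subst (v : ℕ → H) (σ : ℕ → Form) (φ : Form) :
    (φ.subst σ).eval v = φ.eval fun n => (σ n).eval v := by
  induction φ <;> simp_all [Form.subst, Form.eval]

lemma valid_of_mem_ipcAxioms {φ : Form} (h : φ ∈ ipcAxioms) : φ.Valid H := by
  intro v
  simp only [ipcAxioms, Set.mem_insert_iff, Set.mem_singleton_iff] at h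
  rcases h with rfl | rfl | rfl | rfl | rfl | rfl | rfl | rfl | rfl <;>
    simp only [Form.eval, p, q, r, himp_eq_top_iff, le_himp_iff, bot_le, inf_le_left, inf_le_right,
      le_sup_left, le_sup_right]
  · generalize v 0 = x, v 1 = y, v 2 = z
    have h1 : (x ⇨ y ⇨ z) ⊓ x ≤ y ⇨ z := himp_inf_le
    have h2 : (x ⇨ y) ⊓ x ≤ y := himp_inf_le
    calc (x ⇨ y ⇨ z) ⊓ (x ⇨ y) ⊓ x ≤ (y ⇨ z) ⊓ y :=
          le_inf ((inf_le_inf_right _ inf_le_left).trans h1)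
            ((inf_le_inf_right _ inf_le_right).trans h2)
      _ ≤ z := himp_inf_le
  · exact le_rfl
  · rw [inf_sup_left]
    exact sup_le ((inf_le_inf_right _ inf_le_left).trans himp_inf_le)
      ((inf_le_inf_right _ inf_le_right).trans himp_inf_le)

lemma valid_of_mem_coimpAxioms {φ : Form} (h : φ ∈ coimpAxioms) : φ.Valid H := by
  intro v
  simp only [coimpAxioms, Set.mem_insert_iff, Set.mem_singleton_iff] at h
  rcases h with rfl | rfl | rfl | rfl | rfl <;>
    simp only [Form.eval, Form.dneg, Form.neg, Form.eval_top, p, q, r, himp_eq_top_iff,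
      le_himp_iff, sdiff_self, le_refl]
  · exact le_sup_sdiff
  · generalize v 0 = x, v 1 = y
    rw [sdiff_le_iff]
    have h : x ≤ (x ⇨ y) ⊔ ⊤ \ (x ⇨ y) := le_top.trans le_sup_sdiff
    calc x ≤ x ⊓ ((x ⇨ y) ⊔ ⊤ \ (x ⇨ y)) := le_inf le_rfl h
      _ ≤ y ⊔ ⊤ \ (x ⇨ y) := by
        rw [inf_sup_left]
        exact sup_le_sup inf_himp_le inf_le_right
  · rw [sdiff_sdiff]
  · generalize v 0 = x, v 1 = y
    calc (x \ y ⇨ ⊥) ⊓ x ≤ (x \ y ⇨ ⊥) ⊓ (y ⊔ x \ y) := inf_le_inf_left _ le_sup_sdiff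
      _ ≤ y := by
        rw [inf_sup_left]
        exact sup_le inf_le_right (himp_inf_le.trans bot_le)

theorem Derivable.valid {Γ : Set Form} (hΓ : ∀ ψ ∈ Γ, ψ.Valid H) {φ : Form}
    (h : Derivable Γ φ) : φ.Valid H := by
  induction h with
  | ipc h => exact valid_of_mem_ipcAxioms h
  | co h => exact valid_of_mem_coimpAxioms h
  | ax h => exact hΓ _ h
  | subst σ _ ih => exact fun v => (Form.eval_subst v σ _).trans (ih _)
  | mp _ _ ih₁ ih₂ =>
    intro v
    have h := ih₁ v
    rwa [Form.eval, ih₂ v, top_himp] at h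
  | neg_dneg _ ih =>
    intro v
    simp [Form.neg, Form.dneg, Form.eval, Form.eval_top, ih v]

lemma Derivable.mono {Γ Δ : Set Form} (hΓ : Γ ⊆ Δ) {φ : Form} (h : Derivable Γ φ) :
    Derivable Δ φ := by
  induction h with
  | ipc h => exact .ipc h
  | co h => exact .co h
  | ax h => exact .ax (hΓ h)
  | subst σ _ ih => exact .subst σ ih
  | mp _ _ ih₁ ih₂ => exact .mp ih₁ ih₂
  | neg_dneg _ ih => exact .neg_dneg ih

lemma closedUnderRules_HBPlus (Γ : Set Form) : ClosedUnderRules (HBPlus Γ) where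
  subst _ σ h := Derivable.subst σ h
  mp _ _ h₁ h₂ := Derivable.mp h₁ h₂
  neg_dneg _ h := Derivable.neg_dneg h

end Soundness

/-! ## The ladder of formulas in Heyting algebras -/

section Ladder

variable {H : Type*}

/-- The values of `beta n`; those of `gamma n` are `rung y x n`. -/
def rung [HeytingAlgebra H] : H → H → ℕ → H
  | x, y, 0 => y ⇨ x
  | x, y, 1 => (x ⇨ y) ⇨ ((y ⇨ x) ⊔ y)
  | x, y, n + 2 => rung y x (n + 1) ⇨ (rung x y (n + 1) ⊔ rung y x n)

/-- The values of `beta (n + 2) ⋏ gamma (n + 2)`. -/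
def rungInf [HeytingAlgebra H] (x y : H) (n : ℕ) : H :=
  rung x y (n + 2) ⊓ rung y x (n + 2)

/-- The values of `alpha n`. -/
def knot [HeytingAlgebra H] (x y : H) (n : ℕ) : H :=
  rungInf x y n ⇨ (rung x y (n + 1) ⊔ rung y x (n + 1))

lemma eval_betaGamma [BiheytingAlgebra H] (v : ℕ → H) (n : ℕ) :
    (beta n).eval v = rung (v 0) (v 1) n ∧ (gamma n).eval v = rung (v 1) (v 0) n := by
  induction n using Nat.twoStepInduction with
  | zero => exact ⟨rfl, rfl⟩
  | one => exact ⟨rfl, rfl⟩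
  | more n ih₁ ih₂ =>
    simp only [beta, gamma] at ih₁ ih₂
    simp [beta, gamma, betaGamma, rung, Form.eval, ih₁, ih₂]

lemma eval_alpha [BiheytingAlgebra H] (v : ℕ → H) (n : ℕ) :
    (alpha n).eval v = knot (v 0) (v 1) n := by
  simp [alpha, Form.eval, knot, rungInf, eval_betaGamma]

variable [HeytingAlgebra H] (x y : H)

lemma rungInf_comm (n : ℕ) : rungInf x y n = rungInf y x n := inf_comm _ _

lemma knot_comm (n : ℕ) : knot x y n = knot y x n := by
  rw [knot, knot, rungInf_comm, sup_comm]

lemma rung_mono : Monotone (rung x y) := by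
  refine monotone_nat_of_le_succ fun n => ?_
  cases n with
  | zero => exact le_sup_left.trans le_himp
  | succ n => exact le_sup_left.trans le_himp

lemma rungInf_mono : Monotone (rungInf x y) := fun _ _ h =>
  inf_le_inf (rung_mono x y (by omega)) (rung_mono y x (by omega))

lemma rungInf_le_knot {n k : ℕ} (h : n < k) : rungInf x y n ≤ knot x y k :=
  (inf_le_left.trans ((rung_mono x y (by omega)).trans le_sup_left)).trans le_himp

lemma rung_shift_zero : rung (rung x y 0 ⊔ y) (rung y x 0 ⊔ x) 0 = rung x y 1 := by
  change ((x ⇨ y) ⊔ x) ⇨ ((y ⇨ x) ⊔ y) = (x ⇨ y) ⇨ ((y ⇨ x) ⊔ y)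
  rw [sup_himp_distrib]
  exact inf_eq_left.2 (by rw [himp_eq_top_iff.2 (le_himp.trans le_sup_left)]; exact le_top)

/-- The substitution p ↦ β₀ ∨ q, q ↦ γ₀ ∨ p moves the whole ladder up one step. It turns axioms
stated at level 0 into laws at every level. -/
lemma rung_shift (n : ℕ) (x y : H) :
    rung (rung x y 0 ⊔ y) (rung y x 0 ⊔ x) n = rung x y (n + 1) := by
  induction n using Nat.twoStepInduction generalizing x y with
  | zero => exact rung_shift_zero x y
  | one =>
    -- Rung 1 ends in a variable instead of a lower rung, so the substitution leaves a surplus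
    -- disjunct `x`; it is absorbed here.
    have h : x ≤ rung x y 1 := (le_himp (a := x) (b := y)).trans (rung_mono x y zero_le_one)
    have h₁ := rung_shift_zero x y
    have h₂ := rung_shift_zero y x
    rw [rung] at h₁ h₂
    change _ ⇨ (_ ⊔ _) = rung y x 1 ⇨ (rung x y 1 ⊔ rung y x 0)
    rw [h₁, h₂, ← sup_assoc, sup_right_comm, sup_eq_left.2 h]
  | more n ih₁ ih₂ =>
    change rung (rung y x 0 ⊔ x) (rung x y 0 ⊔ y) (n + 1) ⇨
      (rung (rung x y 0 ⊔ y) (rung y x 0 ⊔ x) (n + 1) ⊔ rung (rung y x 0 ⊔ x) (rung x y 0 ⊔ y) n) =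
        _
    rw [ih₂, ih₂, ih₁]
    rfl

lemma knot_shift (n : ℕ) : knot (rung x y 0 ⊔ y) (rung y x 0 ⊔ x) n = knot x y (n + 1) := by
  simp only [knot, rungInf, rung_shift]

variable {x y}

lemma knot_himp_le (h : ∀ x y : H, knot x y 0 ⇨ (knot x y 1 ⊔ knot x y 2) ≤
    knot x y 0 ⊔ knot x y 1) (n : ℕ) (x y : H) :
    knot x y n ⇨ (knot x y (n + 1) ⊔ knot x y (n + 2)) ≤ knot x y n ⊔ knot x y (n + 1) := by
  induction n generalizing x y with
  | zero => exact h x y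
  | succ n ih => simpa only [knot_shift] using ih (rung x y 0 ⊔ y) (rung y x 0 ⊔ x)

lemma knot_succ_le_rung (h : ∀ x y : H, knot x y 1 ≤ knot x y 0 ⊔ rung x y 2) (n : ℕ) (x y : H) :
    knot x y (n + 1) ≤ knot x y n ⊔ rung x y (n + 2) := by
  induction n generalizing x y with
  | zero => exact h x y
  | succ n ih =>
    simpa only [knot_shift, rung_shift] using ih (rung x y 0 ⊔ y) (rung y x 0 ⊔ x)

/-- Knots are symmetric in `x` and `y`, so the axiom applies in both orders; distributivity merges
the two bounds. -/
lemma knot_succ_le (h : ∀ x y : H, knot x y 1 ≤ knot x y 0 ⊔ rung x y 2) (n : ℕ) (x y : H) :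
    knot x y (n + 1) ≤ knot x y n ⊔ rungInf x y n := by
  rw [rungInf, sup_inf_left]
  refine le_inf (knot_succ_le_rung h n x y) ?_
  rw [knot_comm x y, knot_comm x y]
  exact knot_succ_le_rung h n y x

end Ladder

/-! ## Complete bi-Heyting algebras -/

section Complete

variable {H : Type*}

/-- The map `a ⊔ ·` has coimplication as a left adjoint, hence preserves every existing infimum. -/
lemma le_sup_of_isGLB [BiheytingAlgebra H] {ι : Type*} {f : ι → H} {s : Set ι} {m a c : H}
    (hm : IsGLB (f '' s) m) (h : ∀ i ∈ s, c ≤ a ⊔ f i) : c ≤ a ⊔ m := by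
  rw [← sdiff_le_iff]
  refine hm.2 ?_
  rintro _ ⟨i, hi, rfl⟩
  exact sdiff_le_iff.2 (h i hi)

/-- The laws of the elements `alpha n`, with `e n` the value of `beta (n + 2) ⋏ gamma (n + 2)`. -/
structure IsKnotSequence [HeytingAlgebra H] (α e : ℕ → H) : Prop where
  inf_le : ∀ {n : ℕ} {g : H}, g ⊓ e n ≤ α n → g ≤ α n
  mono : Monotone e
  le_of_lt : ∀ {n k : ℕ}, n < k → e n ≤ α k
  himp_le : ∀ n, α n ⇨ (α (n + 1) ⊔ α (n + 2)) ≤ α n ⊔ α (n + 1)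
  succ_le : ∀ n, α (n + 1) ≤ α n ⊔ e n

namespace IsKnotSequence

section

variable [HeytingAlgebra H] {α e : ℕ → H} (h : IsKnotSequence α e)

include h

/-- If e lies below α (k + 1) ⊔ α (k + 2), it lies below the implication in `himp_le`, and so below
α k ⊔ α (k + 1). Thus the pair can be moved down one level at a time. -/
lemma le_delta (d k : ℕ) : e (k + d) ≤ α k ⊔ α (k + 1) := by
  induction d generalizing k with
  | zero => exact (h.le_of_lt (by omega)).trans le_sup_right
  | succ d ih =>
    have h₁ := ih (k + 1)
    rw [show k + 1 + d = k + (d + 1) by omega] at h₁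
    exact (h₁.trans le_himp).trans (h.himp_le k)

/-- Iterating `succ_le` descends from α (k + d) to α k; the terms e k, …, e (k + d - 1) collected on
the way are all at most `e j`. -/
lemma le_sup_e {k j : ℕ} (d : ℕ) (hj : k + d ≤ j + 1) : α (k + d) ≤ α k ⊔ e j := by
  induction d with
  | zero => exact le_sup_left
  | succ d ih =>
    exact (h.succ_le (k + d)).trans
      (sup_le (ih (by omega)) ((h.mono (by omega)).trans le_sup_right))

/-- Only k < n needs work: `le_delta` bounds e n by α (n - 1) ⊔ α n, and the descent from α (n - 1)
to α k costs only an e of index below n, which α n absorbs. -/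
lemma e_le_of_ne {n k : ℕ} (hk : k ≠ n) : e n ≤ α n ⊔ α k := by
  rcases lt_or_gt_of_ne hk with hlt | hlt
  · obtain ⟨m, rfl⟩ : ∃ m, n = m + 1 := ⟨n - 1, by omega⟩
    have h₁ : e (m + 1) ≤ α m ⊔ α (m + 1) := h.le_delta 1 m
    refine h₁.trans (sup_le ?_ le_sup_left)
    rcases (Nat.lt_succ_iff.1 hlt).eq_or_lt with rfl | hlt'
    · exact le_sup_right
    · have h₂ := h.le_sup_e (k := k) (j := m - 1) (m - k) (by omega)
      rw [Nat.add_sub_cancel' hlt'.le] at h₂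
      exact h₂.trans (sup_le le_sup_right ((h.le_of_lt (by omega)).trans le_sup_left))
  · exact (h.le_of_lt hlt).trans le_sup_right

lemma e_le_sup {i k : ℕ} (hik : i < k) (j : ℕ) : e j ≤ α i ⊔ α k := by
  induction j with
  | zero => exact (h.le_of_lt (by omega)).trans le_sup_right
  | succ j ih =>
    rcases lt_trichotomy (j + 1) k with hj | rfl | hj
    · exact (h.le_of_lt hj).trans le_sup_right
    · exact (h.e_le_of_ne hik.ne).trans (sup_comm _ _).le
    · refine (h.e_le_of_ne (hik.trans hj).ne).trans (sup_le ?_ le_sup_left)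
      have h₂ := h.le_sup_e (k := k) (j := j) (j + 1 - k) (by omega)
      rw [Nat.add_sub_cancel' hj.le] at h₂
      exact h₂.trans (sup_le le_sup_right ih)

/-- One index n beyond both i and k suffices: α n descends to the larger of the two at the cost of e
n, and any two distinct α's dominate every e. -/
lemma le_sup_of_frequently {g : H} (hg : ∀ N, ∃ n > N, g ≤ α n) {i k : ℕ} (hik : i ≠ k) :
    g ≤ α i ⊔ α k := by
  wlog hlt : i < k generalizing i k
  · rw [sup_comm]
    exact this hik.symm (by omega)
  obtain ⟨n, hn, hgn⟩ := hg k
  have h₂ := h.le_sup_e (k := k) (j := n) (n - k) (by omega)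
  rw [Nat.add_sub_cancel' hn.le] at h₂
  exact hgn.trans (h₂.trans (sup_le le_sup_right (h.e_le_sup hlt n)))

end

variable [BiheytingAlgebra H] {α e : ℕ → H}

lemma himp_sup_le (h : IsKnotSequence α e) {m : ℕ → H}
    (hm : ∀ i, IsGLB (α '' {n | n % 3 ≠ i}) (m i)) {i j k : ℕ}
    (hi : i < 3) (hj : j < 3) (hk : k < 3) (hij : i ≠ j) (hik : i ≠ k) (hjk : j ≠ k) :
    m i ⇨ (m j ⊔ m k) ≤ m j ⊔ m k := by
  have hle : ∀ {n l : ℕ}, n % 3 ≠ l → m l ≤ α n := fun hn => (hm _).1 ⟨_, hn, rfl⟩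
  -- For n ≡ i, distributivity gives e n ≤ α n ⊔ m i. Meeting with the implication turns m i into m
  -- j ⊔ m k, which is below α n since n is in neither class j nor k; `inf_le` then removes e n.
  have key : ∀ n, n % 3 = i → m i ⇨ (m j ⊔ m k) ≤ α n := by
    intro n hn
    refine h.inf_le ?_
    have h₁ : e n ≤ α n ⊔ m i := by
      refine le_sup_of_isGLB (hm i) fun l hl => h.e_le_of_ne ?_
      rintro rfl
      exact hl hn
    refine (inf_le_inf_left _ h₁).trans ?_
    rw [inf_sup_left]
    exact sup_le inf_le_right (himp_inf_le.trans (sup_le (hle (by omega)) (hle (by omega))))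
  -- Distributing over both infima leaves the bound α l ⊔ α n with l ≢ k and n ≢ j.
  refine le_sup_of_isGLB (hm k) fun l hl => ?_
  refine (le_sup_of_isGLB (a := α l) (hm j) fun n hn => ?_).trans (sup_comm _ _).le
  by_cases hl' : l % 3 = i
  · exact (key l hl').trans le_sup_left
  by_cases hn' : n % 3 = i
  · exact (key n hn').trans le_sup_right
  simp only [Set.mem_ofPred_eq] at hl hn
  -- What remains is l ≡ j and n ≡ k, so l ≠ n, and `key` supplies arbitrarily large indices in
  -- class i.
  refine h.le_sup_of_frequently (fun N => ⟨3 * (N + 1) + i, by omega, key _ (by omega)⟩) ?_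
  rintro rfl
  omega

theorem sup_eq_top (h : IsKnotSequence α e) (hglb : ∀ s : Set H, ∃ x, IsGLB s x)
    (hbb : ∀ a b c : H, ((a ⇨ (b ⊔ c)) ⇨ (b ⊔ c)) ⊓ ((b ⇨ (a ⊔ c)) ⇨ (a ⊔ c)) ⊓
      ((c ⇨ (a ⊔ b)) ⇨ (a ⊔ b)) ≤ a ⊔ b ⊔ c) : α 0 ⊔ α 1 = ⊤ := by
  choose m hm using fun i : ℕ => hglb (α '' {n | n % 3 ≠ i})
  have h₀ := hbb (m 0) (m 1) (m 2)
  rw [himp_eq_top_iff.2 (h.himp_sup_le hm (i := 0) (j := 1) (k := 2) (by omega) (by omega)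
      (by omega) (by omega) (by omega) (by omega)),
    himp_eq_top_iff.2 (h.himp_sup_le hm (i := 1) (j := 0) (k := 2) (by omega) (by omega)
      (by omega) (by omega) (by omega) (by omega)),
    himp_eq_top_iff.2 (h.himp_sup_le hm (i := 2) (j := 0) (k := 1) (by omega) (by omega)
      (by omega) (by omega) (by omega) (by omega)), inf_idem, inf_idem] at h₀
  refine top_le_iff.1 (h₀.trans (sup_le (sup_le ?_ ?_) ?_))
  · exact ((hm 0).1 ⟨1, by simp, rfl⟩ : m 0 ≤ α 1).trans le_sup_right
  · exact ((hm 1).1 ⟨0, by simp, rfl⟩ : m 1 ≤ α 0).trans le_sup_left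
  · exact ((hm 2).1 ⟨0, by simp, rfl⟩ : m 2 ≤ α 0).trans le_sup_left

end IsKnotSequence

lemma isKnotSequence_knot [HeytingAlgebra H]
    (h₁ : ∀ x y : H, knot x y 0 ⇨ (knot x y 1 ⊔ knot x y 2) ≤ knot x y 0 ⊔ knot x y 1)
    (h₂ : ∀ x y : H, knot x y 1 ≤ knot x y 0 ⊔ rung x y 2) (x y : H) :
    IsKnotSequence (knot x y) (rungInf x y) where
  inf_le {n g} hg := by
    rw [knot, le_himp_iff] at hg ⊢
    exact (le_inf le_rfl inf_le_right).trans hg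
  mono := rungInf_mono x y
  le_of_lt h := rungInf_le_knot x y h
  himp_le n := knot_himp_le h₁ n x y
  succ_le n := knot_succ_le h₂ n x y

end Complete

/-! ## Validity of the axioms of the Shehtman logic -/

section Axioms

variable {H : Type*} [BiheytingAlgebra H]

lemma valid_shehtman_iff : ((alpha 0 ⟶ₕ delta 1) ⟶ₕ delta 0).Valid H ↔
    ∀ x y : H, knot x y 0 ⇨ (knot x y 1 ⊔ knot x y 2) ≤ knot x y 0 ⊔ knot x y 1 := by
  simp only [Form.Valid, delta, Form.eval, eval_alpha, himp_eq_top_iff]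
  exact ⟨fun h x y => h fun n => if n = 0 then x else y, fun h v => h _ _⟩

lemma valid_kappa_zero_iff : (kappa 0).Valid H ↔
    ∀ x y : H, knot x y 1 ≤ knot x y 0 ⊔ rung x y 2 := by
  simp only [Form.Valid, kappa, Form.eval, eval_alpha, (eval_betaGamma _ _).1, himp_eq_top_iff]
  exact ⟨fun h x y => h fun n => if n = 0 then x else y, fun h v => h _ _⟩

lemma valid_bb2_iff : bb2.Valid H ↔ ∀ a b c : H,
    ((a ⇨ (b ⊔ c)) ⇨ (b ⊔ c)) ⊓ ((b ⇨ (a ⊔ c)) ⇨ (a ⊔ c)) ⊓ ((c ⇨ (a ⊔ b)) ⇨ (a ⊔ b)) ≤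
      a ⊔ b ⊔ c := by
  simp only [Form.Valid, bb2, p, q, r, Form.eval, himp_eq_top_iff]
  exact ⟨fun h x y z => h fun n => if n = 0 then x else if n = 1 then y else z, fun h v => h _ _ _⟩

lemma valid_delta_zero_iff : (delta 0).Valid H ↔
    ∀ x y : H, knot x y 0 ⊔ knot x y 1 = ⊤ := by
  simp only [Form.Valid, delta, Form.eval, eval_alpha]
  exact ⟨fun h x y => h fun n => if n = 0 then x else y, fun h v => h _ _⟩

lemma valid_of_mem_Sh
    (h₁ : ∀ x y : H, knot x y 0 ⇨ (knot x y 1 ⊔ knot x y 2) ≤ knot x y 0 ⊔ knot x y 1)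
    (h₂ : ∀ x y : H, knot x y 1 ≤ knot x y 0 ⊔ rung x y 2)
    (h₃ : ∀ a b c : H, ((a ⇨ (b ⊔ c)) ⇨ (b ⊔ c)) ⊓ ((b ⇨ (a ⊔ c)) ⇨ (a ⊔ c)) ⊓
      ((c ⇨ (a ⊔ b)) ⇨ (a ⊔ b)) ≤ a ⊔ b ⊔ c) {φ : Form} (hφ : φ ∈ Sh) : φ.Valid H := by
  refine Derivable.valid ?_ hφ
  rintro ψ (rfl | rfl | rfl)
  exacts [valid_shehtman_iff.2 h₁, valid_kappa_zero_iff.2 h₂, valid_bb2_iff.2 h₃]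

/-- A bi-Heyting algebra with all infima that validates the Shehtman logic validates `delta 0`. -/
theorem valid_delta_zero_of_complete (hglb : ∀ s : Set H, ∃ x, IsGLB s x)
    (hSh : ∀ ψ ∈ Sh, ψ.Valid H) : (delta 0).Valid H := by
  rw [valid_delta_zero_iff]
  intro x y
  refine (isKnotSequence_knot (valid_shehtman_iff.1 (hSh _ (.ax ?_)))
    (valid_kappa_zero_iff.1 (hSh _ (.ax ?_))) x y).sup_eq_top hglb
    (valid_bb2_iff.1 (hSh _ (.ax ?_))) <;> simp

end Axioms

theorem opValid_delta_zero {X : Type*} [TopologicalSpace X] (h : HasCoimplication (Opens X))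
    (hSh : ∀ ψ ∈ Sh, OpValid X h ψ) : OpValid X h (delta 0) :=
  @valid_delta_zero_of_complete (Opens X) h.toBiheyting (fun s => ⟨sInf s, isGLB_sInf s⟩) hSh

/-! ## The compactified Fine frame -/

namespace FineSpace

open OnePoint FineFrame

lemma coe_le_coe {x y : FineFrame} : (x : FineSpace) ≤ y ↔ FineFrame.le x y := Iff.rfl

lemma coe_le_infty {x : FineFrame} : (x : FineSpace) ≤ ∞ ↔ ∃ n, x = d n := by
  cases x <;> simp only [d.injEq, exists_eq', reduceCtorEq, exists_false] <;> exact Iff.rfl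

lemma infty_le_coe {x : FineFrame} : ∞ ≤ (x : FineSpace) ↔ ∃ n, x = b n ∨ x = c n := by
  cases x <;> simp only [b.injEq, c.injEq, exists_eq', reduceCtorEq, exists_false, or_false,
    false_or] <;> exact Iff.rfl

@[elab_as_elim]
lemma points {P : FineSpace → Prop} (ha : ∀ n, P (a n)) (hb : ∀ n, P (b n)) (hc : ∀ n, P (c n))
    (hd : ∀ n, P (d n)) (h : P ∞) (x : FineSpace) : P x := by
  cases x using OnePoint.rec with
  | infty => exact h
  | coe x =>
    cases x with
    | a n => exact ha n
    | b n => exact hb n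
    | c n => exact hc n
    | d n => exact hd n

/-- Above a b or c lie only b's and c's of smaller index, so one of least index is maximal. If the
set has none, either it is finite or ∞ is maximal, since only b's and c's lie strictly above ∞. -/
lemma exists_maximal {S : Set FineSpace} (hS : IsClopen S) (hne : S.Nonempty) :
    ∃ x ∈ S, ∀ y ∈ S, x ≤ y → y = x := by
  by_cases hbc : ∃ n, (b n : FineSpace) ∈ S ∨ (c n : FineSpace) ∈ S
  · classical
    have hmin : ∀ m, (b m : FineSpace) ∈ S ∨ (c m : FineSpace) ∈ S → Nat.find hbc ≤ m :=
      fun m hm => Nat.find_min' hbc hm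
    rcases Nat.find_spec hbc with h | h <;> refine ⟨_, h, fun y hy hle => ?_⟩ <;>
      induction y using points with
      | ha m => exact hle.elim
      | hd m => exact hle.elim
      | h => exact hle.elim
      | hb m =>
        have := hmin m (.inl hy)
        simp only [coe_le_coe, FineFrame.le] at hle
        first | omega | (congr 2; omega)
      | hc m =>
        have := hmin m (.inr hy)
        simp only [coe_le_coe, FineFrame.le] at hle
        first | omega | (congr 2; omega)
  · push Not at hbc
    rcases (isClopen_iff S).1 hS with ⟨h, hf⟩ | ⟨h, -⟩
    · have hfin : S.Finite := by
        refine (hf.image ((↑) : FineFrame → FineSpace)).subset fun x hx => ?_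
        cases x using OnePoint.rec with
        | infty => exact absurd hx h
        | coe x => exact ⟨x, hx, rfl⟩
      obtain ⟨x, hx⟩ := hfin.exists_maximal hne
      exact ⟨x, hx.1, fun y hy hle => le_antisymm (hx.2 hy hle) hle⟩
    · refine ⟨∞, h, fun y hy hle => ?_⟩
      induction y using points with
      | ha m => exact hle.elim
      | hd m => exact hle.elim
      | h => rfl
      | hb m => exact absurd hy (hbc m).1
      | hc m => exact absurd hy (hbc m).2

/-- Points other than `∞` have at most two covers. -/
lemma exists_covers {x : FineSpace} (hx : x ≠ ∞) :
    ∃ u v, ∀ y, x < y → (x < u ∧ u ≤ y) ∨ (x < v ∧ v ≤ y) := by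
  induction x using points with
  | h => exact absurd rfl hx
  | ha n =>
    refine ⟨b (n + 1), c (n + 1), fun y hy => ?_⟩
    induction y using points <;>
      simp only [lt_iff_le_not_ge] at hy ⊢ <;>
      simp [coe_le_coe, coe_le_infty, infty_le_coe, FineFrame.le] at hy ⊢ <;> omega
  | hb n =>
    -- For small n the truncated subtraction gives points that are not strictly above `b n`; the
    -- conditions `x < u` and `x < v` discard them.
    refine ⟨b (n - 1), c (n - 2), fun y hy => ?_⟩
    induction y using points <;>
      simp only [lt_iff_le_not_ge] at hy ⊢ <;>
      simp [coe_le_coe, coe_le_infty, infty_le_coe, FineFrame.le] at hy ⊢ <;> omega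
  | hc n =>
    refine ⟨c (n - 1), b (n - 2), fun y hy => ?_⟩
    induction y using points <;>
      simp only [lt_iff_le_not_ge] at hy ⊢ <;>
      simp [coe_le_coe, coe_le_infty, infty_le_coe, FineFrame.le] at hy ⊢ <;> omega
  | hd n =>
    refine ⟨a n, d (n + 1), fun y hy => ?_⟩
    induction y using points <;>
      simp only [lt_iff_le_not_ge] at hy ⊢ <;>
      simp [coe_le_coe, coe_le_infty, infty_le_coe, FineFrame.le] at hy ⊢ <;> omega

/-! ### The algebra of clopen upsets -/

lemma mem_himp {U V : FineAlgebra} {x : FineSpace} :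
    x ∈ U ⇨ V ↔ ∀ y, x ≤ y → y ∈ U → y ∈ V := by
  change ¬ (∃ y, (y ∈ U ∧ y ∉ V) ∧ x ≤ y) ↔ _
  push Not
  exact ⟨fun h y hx hU => by_contra fun hV => h y ⟨hU, hV⟩ hx,
    fun h y hUV hx => hUV.2 (h y hx hUV.1)⟩

lemma mem_sup {U V : FineAlgebra} {x : FineSpace} : x ∈ U ⊔ V ↔ x ∈ U ∨ x ∈ V := Iff.rfl

lemma mem_inf {U V : FineAlgebra} {x : FineSpace} : x ∈ U ⊓ V ↔ x ∈ U ∧ x ∈ V := Iff.rfl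

lemma le_iff {U V : FineAlgebra} : U ≤ V ↔ ∀ x, x ∈ U → x ∈ V := Iff.rfl

lemma mem_of_le {U : FineAlgebra} {x y : FineSpace} (h : x ≤ y) (hx : x ∈ U) : y ∈ U :=
  U.upper h hx

/-- At a maximal counterexample x, each premise yields a point above x lying in exactly one of P, Q,
R, a different one each time. Two of these three points share a cover of x; by maximality that cover
lies in P, Q or R, and so both points lie in the same set. -/
lemma bb2_le (P Q R : FineAlgebra) :
    ((P ⇨ (Q ⊔ R)) ⇨ (Q ⊔ R)) ⊓ ((Q ⇨ (P ⊔ R)) ⇨ (P ⊔ R)) ⊓ ((R ⇨ (P ⊔ Q)) ⇨ (P ⊔ Q)) ≤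
      P ⊔ Q ⊔ R := by
  set A := ((P ⇨ (Q ⊔ R)) ⇨ (Q ⊔ R)) ⊓ ((Q ⇨ (P ⊔ R)) ⇨ (P ⊔ R)) ⊓ ((R ⇨ (P ⊔ Q)) ⇨ (P ⊔ Q))
  by_contra hle
  rw [le_iff] at hle
  push Not at hle
  obtain ⟨x, ⟨hxA, hxB⟩, hmax⟩ := exists_maximal
    (S := (A : Set FineSpace) \ (P ⊔ Q ⊔ R : FineAlgebra)) (A.isClopen.diff (P ⊔ Q ⊔ R).isClopen) hle
  have hcov : ∀ y, x < y → (y ∈ P ∨ y ∈ Q) ∨ y ∈ R := by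
    intro y hy
    by_contra hn
    exact hy.ne' (hmax y ⟨mem_of_le hy.le hxA, hn⟩ hy.le)
  have hx : ¬ ((x ∈ P ∨ x ∈ Q) ∨ x ∈ R) := hxB
  by_cases hinf : x = ∞
  · subst hinf
    -- Every b N lies strictly above ∞, hence in P ⊔ Q ⊔ R, whereas a clopen set omitting ∞ has
    -- bounded index.
    rcases exists_bound_of_isClopen (P ⊔ Q ⊔ R).isClopen with ⟨-, N, hN⟩ | ⟨h, -⟩
    · exact lt_irrefl N (hN (b N) (hcov (b N) ⟨trivial, id⟩))
    · exact hx h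
  · have hex : ∀ {T T' T'' : FineAlgebra}, x ∈ (T ⇨ (T' ⊔ T'')) ⇨ (T' ⊔ T'') → x ∉ T → x ∉ T' →
        x ∉ T'' → ∃ y, x < y ∧ y ∈ T ∧ y ∉ T' ∧ y ∉ T'' := by
      intro T T' T'' h hT hT' hT''
      have h₁ : x ∉ T ⇨ (T' ⊔ T'') := fun h₂ =>
        (mem_himp.1 h x le_rfl h₂).elim hT' hT''
      simp only [mem_himp, mem_sup] at h₁
      push Not at h₁
      obtain ⟨y, hxy, hy, hy'⟩ := h₁
      exact ⟨y, lt_of_le_of_ne hxy fun h => hT (h ▸ hy), hy, hy'⟩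
    push Not at hx
    obtain ⟨⟨hA₁, hA₂⟩, hA₃⟩ := hxA
    obtain ⟨y₁, hy₁, h₁⟩ := hex hA₁ hx.1.1 hx.1.2 hx.2
    obtain ⟨y₂, hy₂, h₂⟩ := hex hA₂ hx.1.2 hx.1.1 hx.2
    obtain ⟨y₃, hy₃, h₃⟩ := hex hA₃ hx.2 hx.1.1 hx.1.2
    obtain ⟨u, v, huv⟩ := exists_covers hinf
    have key : ∀ w, x < w → ¬ (w ≤ y₁ ∧ w ≤ y₂) ∧ ¬ (w ≤ y₁ ∧ w ≤ y₃) ∧ ¬ (w ≤ y₂ ∧ w ≤ y₃) := by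
      intro w hw
      have hup : ∀ {T : FineAlgebra} {y}, w ∈ T → w ≤ y → y ∈ T := fun h h' => mem_of_le h' h
      rcases hcov w hw with (h | h) | h
      · exact ⟨fun h' => h₂.2.1 (hup h h'.2), fun h' => h₃.2.1 (hup h h'.2),
          fun h' => h₂.2.1 (hup h h'.1)⟩
      · exact ⟨fun h' => h₁.2.1 (hup h h'.1), fun h' => h₁.2.1 (hup h h'.1),
          fun h' => h₃.2.2 (hup h h'.2)⟩
      · exact ⟨fun h' => h₁.2.2 (hup h h'.1), fun h' => h₁.2.2 (hup h h'.1),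
          fun h' => h₂.2.2 (hup h h'.1)⟩
    rcases huv y₁ hy₁ with ⟨hw, hw₁⟩ | ⟨hw, hw₁⟩ <;>
      rcases huv y₂ hy₂ with ⟨hw', hw₂⟩ | ⟨hw', hw₂⟩ <;>
      rcases huv y₃ hy₃ with ⟨hw'', hw₃⟩ | ⟨hw'', hw₃⟩ <;>
      first
      | exact (key _ hw).1 ⟨hw₁, hw₂⟩
      | exact (key _ hw).2.1 ⟨hw₁, hw₃⟩
      | exact (key _ hw').2.2 ⟨hw₂, hw₃⟩

/-! ### Values of the ladder -/

/-- The order-theoretic properties of the chains `b` and `c`, which are symmetric in them. -/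
structure IsSides (B C : ℕ → FineSpace) : Prop where
  BB : ∀ {m n}, B m ≤ B n ↔ n ≤ m
  CC : ∀ {m n}, C m ≤ C n ↔ n ≤ m
  BC : ∀ {m n}, B m ≤ C n ↔ n + 2 ≤ m
  CB : ∀ {m n}, C m ≤ B n ↔ n + 2 ≤ m
  aB : ∀ {m n}, (a m : FineSpace) ≤ B n ↔ n ≤ m + 1
  aC : ∀ {m n}, (a m : FineSpace) ≤ C n ↔ n ≤ m + 1
  cases : ∀ x, (∃ n, x = B n) ∨ (∃ n, x = C n) ∨ (∃ n : ℕ, x = (a n : FineSpace)) ∨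
    ∀ n, x ≤ B n ∧ x ≤ C n
  of_a_le : ∀ {m x}, (a m : FineSpace) ≤ x → x = (a m : FineSpace) ∨
    (∃ n ≤ m + 1, x = B n) ∨ ∃ n ≤ m + 1, x = C n

lemma isSides : IsSides (fun n => b n) (fun n => c n) where
  BB := Iff.rfl
  CC := Iff.rfl
  BC := Iff.rfl
  CB := Iff.rfl
  aB := Iff.rfl
  aC := Iff.rfl
  cases x := by
    induction x using points with
    | ha n => exact .inr (.inr (.inl ⟨n, rfl⟩))
    | hb n => exact .inl ⟨n, rfl⟩
    | hc n => exact .inr (.inl ⟨n, rfl⟩)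
    | hd n => exact .inr (.inr (.inr fun _ => ⟨trivial, trivial⟩))
    | h => exact .inr (.inr (.inr fun _ => ⟨trivial, trivial⟩))
  of_a_le {m x} h := by
    induction x using points with
    | ha n => exact .inl (congrArg (fun k => ((a k : FineFrame) : FineSpace)) (h : m = n).symm)
    | hb n => exact .inr (.inl ⟨n, h, rfl⟩)
    | hc n => exact .inr (.inr ⟨n, h, rfl⟩)
    | hd n => exact h.elim
    | h => exact h.elim

lemma IsSides.symm {B C : ℕ → FineSpace} (h : IsSides B C) : IsSides C B where
  BB := h.CC
  CC := h.BB
  BC := h.CB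
  CB := h.BC
  aB := h.aC
  aC := h.aB
  cases x := by
    have := h.cases x
    simp only [and_comm (a := x ≤ C _)]
    tauto
  of_a_le hx := (h.of_a_le hx).imp_right Or.symm

/-- `U` and `V` separate `B n` and `C n` minimally. -/
structure IsBase (B C : ℕ → FineSpace) (n : ℕ) (U V : FineAlgebra) : Prop where
  sides : IsSides B C
  B_mem : B n ∈ U
  B_notMem : B n ∉ V
  C_mem : C n ∈ V
  C_notMem : C n ∉ U
  B_succ : ∀ w, B (n + 1) ≤ w → w ∈ V → w ∈ U
  C_succ : ∀ w, C (n + 1) ≤ w → w ∈ U → w ∈ V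
  B_succ_notMem : B (n + 1) ∉ U
  C_succ_notMem : C (n + 1) ∉ V

namespace IsBase

variable {B C : ℕ → FineSpace} {n : ℕ} {U V : FineAlgebra}

lemma symm (h : IsBase B C n U V) : IsBase C B n V U :=
  ⟨h.sides.symm, h.C_mem, h.C_notMem, h.B_mem, h.B_notMem, h.C_succ, h.B_succ,
    h.C_succ_notMem, h.B_succ_notMem⟩

lemma mem_rung_one (h : IsBase B C n U V) (x : FineSpace) :
    x ∈ rung U V 1 ↔ ¬ x ≤ C (n + 1) := by
  have hs := h.sides
  constructor
  · intro hx hle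
    rcases mem_himp.1 hx _ hle (mem_himp.2 h.C_succ) with h' | h'
    · exact h.C_notMem (mem_himp.1 h' _ (hs.CC.2 (by omega)) h.C_mem)
    · exact h.C_succ_notMem h'
  · intro hx
    refine mem_himp.2 fun y hxy hy => mem_sup.2 ?_
    have hy' : ¬ y ≤ C (n + 1) := fun h' => hx (hxy.trans h')
    have hBn : ¬ y ≤ B n := fun h' => h.B_notMem (mem_himp.1 hy _ h' h.B_mem)
    have hBU : ∀ {m}, m ≤ n → B m ∈ U := fun hm => mem_of_le (hs.BB.2 hm) h.B_mem
    have hCV : ∀ {m}, m ≤ n → C m ∈ V := fun hm => mem_of_le (hs.CC.2 hm) h.C_mem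
    rcases hs.cases y with ⟨m, rfl⟩ | ⟨m, rfl⟩ | ⟨m, rfl⟩ | h'
    · rw [hs.BB] at hBn
      exact .inr (h.C_succ _ (hs.CB.2 (by omega)) (hBU (by omega)))
    · rw [hs.CC] at hy'
      exact .inr (hCV (by omega))
    · rw [hs.aB] at hBn
      by_cases hV : (a m : FineSpace) ∈ V
      · exact .inr hV
      refine .inl (mem_himp.2 fun w hw hwV => ?_)
      rcases hs.of_a_le hw with rfl | ⟨k, hk, rfl⟩ | ⟨k, hk, rfl⟩
      · exact absurd hwV hV
      · exact hBU (by omega)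
      · exact h.B_succ _ (hs.BC.2 (by omega)) hwV
    · exact absurd (h' _).2 hy'

/-- This case is separate because the value of `U ⇨ V` is only partly known: it fails below B n and
holds at C (n + 1), which is enough. -/
lemma mem_rung_two (h : IsBase B C n U V) (x : FineSpace) :
    x ∈ rung U V 2 ↔ ¬ x ≤ C (n + 2) := by
  have hs := h.sides
  change x ∈ rung V U 1 ⇨ (rung U V 1 ⊔ (U ⇨ V)) ↔ _
  simp only [mem_himp (U := rung V U 1), mem_sup, h.mem_rung_one, h.symm.mem_rung_one]
  constructor
  · intro hx hle
    rcases hx _ hle (by rw [hs.CB]; omega) with h' | h'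
    · rw [hs.CC] at h'
      omega
    · exact h.B_notMem (mem_himp.1 h' _ (hs.CB.2 le_rfl) h.B_mem)
  · intro hx y hxy hy
    by_contra hn
    push Not at hn
    have hy' : ¬ y ≤ C (n + 2) := fun h' => hx (hxy.trans h')
    rcases hs.cases y with ⟨m, rfl⟩ | ⟨m, rfl⟩ | ⟨m, rfl⟩ | h'
    · simp only [hs.BB, hs.BC] at *
      omega
    · simp only [hs.CB, hs.CC] at *
      obtain rfl : m = n + 1 := by omega
      exact hn.2 (mem_himp.2 h.C_succ)
    · simp only [hs.aB, hs.aC] at *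
      omega
    · exact hy (h' _).1

lemma mem_rung_succ (h : IsBase B C n U V) (j : ℕ) (x : FineSpace) :
    x ∈ rung U V (j + 1) ↔ ¬ x ≤ C (n + j + 1) := by
  induction j using Nat.twoStepInduction generalizing B C U V x with
  | zero => exact h.mem_rung_one x
  | one => exact h.mem_rung_two x
  | more j ih₁ ih₂ =>
    have hs := h.sides
    change x ∈ rung V U (j + 2) ⇨ (rung U V (j + 2) ⊔ rung V U (j + 1)) ↔ _
    simp only [mem_himp, mem_sup, ih₂ h, ih₂ h.symm, ih₁ h.symm]
    constructor
    · intro hx hle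
      have := hx _ hle
      simp only [hs.CB, hs.CC] at this
      omega
    · intro hx y hxy hy
      have hy' : ¬ y ≤ C (n + (j + 2) + 1) := fun h' => hx (hxy.trans h')
      rcases hs.cases y with ⟨m, rfl⟩ | ⟨m, rfl⟩ | ⟨m, rfl⟩ | h'
      · simp only [hs.BB, hs.BC] at *
        omega
      · simp only [hs.CB, hs.CC] at *
        omega
      · simp only [hs.aB, hs.aC] at *
        omega
      · exact absurd (h' _).1 hy

/-- The point a (n + j) is the only one below both B and C at level n + j + 1 but below neither at
level n + j + 2. -/
lemma mem_knot (h : IsBase B C n U V) (j : ℕ) (x : FineSpace) :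
    x ∈ knot U V j ↔ ¬ x ≤ a (n + j) := by
  have hs := h.sides
  simp only [knot, rungInf, mem_himp, mem_sup, mem_inf, h.mem_rung_succ, h.symm.mem_rung_succ]
  constructor
  · intro hx hle
    have := hx _ hle
    simp only [hs.aB, hs.aC] at this
    omega
  · intro hx y hxy hy
    have hy' : ¬ y ≤ a (n + j) := fun h' => hx (hxy.trans h')
    rcases hs.cases y with ⟨m, rfl⟩ | ⟨m, rfl⟩ | ⟨m, rfl⟩ | h'
    · simp only [hs.BB, hs.BC] at *
      omega
    · simp only [hs.CB, hs.CC] at *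
      omega
    · simp only [hs.aB, hs.aC, coe_le_coe, FineFrame.le] at *
      omega
    · exact absurd (h' _).1 hy.2

end IsBase

/-- The hypotheses make b₀ and c₀ incomparable, each with a point strictly below it that is not
below the other. Unequal levels fail: all points strictly below c (n + 1) are below b n. At equal
levels, b (n + 1) is the only point strictly below b n and not below c n. -/
lemma eq_of_incomparable {b₀ b₁ c₀ c₁ : FineSpace} (hb : b₁ ≤ b₀) (hb' : ¬ b₀ ≤ b₁)
    (hc : c₁ ≤ c₀) (hc' : ¬ c₀ ≤ c₁) (hbc : ¬ b₁ ≤ c₀) (hcb : ¬ c₁ ≤ b₀) :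
    ∃ n : ℕ, (b₀ = b n ∧ b₁ = b (n + 1) ∧ c₀ = c n ∧ c₁ = c (n + 1)) ∨
      (b₀ = c n ∧ b₁ = c (n + 1) ∧ c₀ = b n ∧ c₁ = b (n + 1)) := by
  induction b₀ using points <;> induction c₀ using points <;> induction b₁ using points <;>
    simp [coe_le_coe, coe_le_infty, infty_le_coe, FineFrame.le] at hb hb' hbc <;>
    induction c₁ using points <;>
    simp [coe_le_coe, coe_le_infty, infty_le_coe, FineFrame.le] at hc hc' hcb ⊢ <;> omega

/-- A failure of β₁ provides c₁ ≤ c₀ where c₁ forces U → V but not V, and c₀ is in V but not U. A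
failure of γ₁ provides the mirror pair, and the frame order then fixes all four points. -/
lemma exists_isBase {U V : FineAlgebra} {z : FineSpace} (h₁ : z ∉ rung U V 1)
    (h₂ : z ∉ rung V U 1) : ∃ B C n, IsBase B C n U V := by
  have key : ∀ {U V : FineAlgebra}, z ∉ rung U V 1 → ∃ c₁ c₀, c₁ ≤ c₀ ∧
      (∀ w, c₁ ≤ w → w ∈ U → w ∈ V) ∧ c₁ ∉ V ∧ c₀ ∈ V ∧ c₀ ∉ U := by
    intro U V h
    simp only [rung, mem_himp, mem_sup] at h
    push Not at h
    obtain ⟨c₁, -, h, ⟨c₀, hle, h₀⟩, h'⟩ := h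
    exact ⟨c₁, c₀, hle, h, h', h₀⟩
  obtain ⟨c₁, c₀, hc, hcU, hc₁, hc₀, hc₀'⟩ := key h₁
  obtain ⟨b₁, b₀, hb, hbV, hb₁, hb₀, hb₀'⟩ := key h₂
  obtain ⟨n, h | h⟩ := eq_of_incomparable hb (fun h => hb₁ (mem_of_le h hb₀)) hc
    (fun h => hc₁ (mem_of_le h hc₀)) (fun h => hc₀' (hbV _ h hc₀)) (fun h => hb₀' (hcU _ h hb₀))
  · obtain ⟨rfl, rfl, rfl, rfl⟩ := h
    exact ⟨_, _, n, isSides, hb₀, hb₀', hc₀, hc₀', hbV, hcU, hb₁, hc₁⟩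
  · obtain ⟨rfl, rfl, rfl, rfl⟩ := h
    exact ⟨_, _, n, isSides.symm, hb₀, hb₀', hc₀, hc₀', hbV, hcU, hb₁, hc₁⟩

lemma knot_zero_eq_top_or (U V : FineAlgebra) :
    knot U V 0 = ⊤ ∨ ∃ B C n, IsBase B C n U V := by
  rw [or_iff_not_imp_right]
  intro h
  refine top_le_iff.1 (le_iff.2 fun x _ => mem_himp.2 fun y _ _ => ?_)
  by_contra hy
  rw [mem_sup, not_or] at hy
  exact h (exists_isBase hy.1 hy.2)

lemma shehtman_le (U V : FineAlgebra) :
    knot U V 0 ⇨ (knot U V 1 ⊔ knot U V 2) ≤ knot U V 0 ⊔ knot U V 1 := by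
  rcases knot_zero_eq_top_or U V with h | ⟨B, C, n, h⟩
  · simp [h]
  refine le_iff.2 fun x hx => ?_
  by_contra hn
  simp only [mem_himp, mem_sup, h.mem_knot, not_or, not_not] at hx hn
  induction x using points with
  | hd k =>
    -- The point d (n + 1) is above x = d k and below a (n + 1) and a (n + 2), but not below a n, so
    -- it violates the implication.
    have := hx (d (n + 1))
    simp only [coe_le_coe, FineFrame.le] at hn this
    omega
  | ha k =>
    simp only [coe_le_coe, FineFrame.le] at hn
    omega
  | hb k => exact hn.1
  | hc k => exact hn.1
  | h => exact hn.1

lemma kappa_le (U V : FineAlgebra) : knot U V 1 ≤ knot U V 0 ⊔ rung U V 2 := by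
  rcases knot_zero_eq_top_or U V with h | ⟨B, C, n, h⟩
  · simp [h]
  refine le_iff.2 fun x hx => ?_
  by_contra hn
  simp only [mem_sup, h.mem_knot, h.mem_rung_two, not_or, not_not] at hx hn
  obtain ⟨hn, hn'⟩ := hn
  induction x using points with
  | hd k =>
    simp only [coe_le_coe, FineFrame.le] at hn hx
    omega
  | ha k =>
    rw [h.sides.aC] at hn'
    simp only [coe_le_coe, FineFrame.le] at hn
    omega
  | hb k => exact hn
  | hc k => exact hn
  | h => exact hn

/-- The clopen upset of a maximal point. -/
def singleton (x : FineFrame) (hx : ∀ y : FineSpace, (x : FineSpace) ≤ y → y = x) :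
    FineAlgebra where
  carrier := {(x : FineSpace)}
  isClopen' := isClopen_of_finite (OnePoint.infty_ne_coe x) (x.index + 1) fun y hy => by
    rw [OnePoint.coe_injective hy]
    exact Nat.lt_succ_self _
  upper' := by
    rintro y z hyz rfl
    exact hx z hyz

lemma mem_singleton {x : FineFrame} {hx : ∀ y : FineSpace, (x : FineSpace) ≤ y → y = x}
    {y : FineSpace} : y ∈ singleton x hx ↔ y = x := Iff.rfl

lemma eq_of_b_zero_le (y : FineSpace) (hy : (b 0 : FineSpace) ≤ y) : y = b 0 := by
  induction y using points <;>
    simp [coe_le_coe, coe_le_infty, FineFrame.le] at hy ⊢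
  omega

lemma eq_of_c_zero_le (y : FineSpace) (hy : (c 0 : FineSpace) ≤ y) : y = c 0 := by
  induction y using points <;>
    simp [coe_le_coe, coe_le_infty, FineFrame.le] at hy ⊢
  omega

lemma isBase_singleton : IsBase (fun n => b n) (fun n => c n) 0 (singleton (b 0) eq_of_b_zero_le)
    (singleton (c 0) eq_of_c_zero_le) where
  sides := isSides
  B_mem := rfl
  B_notMem := by simp [mem_singleton]
  C_mem := rfl
  C_notMem := by simp [mem_singleton]
  B_succ := by
    rintro w hw rfl
    simp [coe_le_coe, FineFrame.le] at hw
  C_succ := by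
    rintro w hw rfl
    simp [coe_le_coe, FineFrame.le] at hw
  B_succ_notMem := by simp [mem_singleton]
  C_succ_notMem := by simp [mem_singleton]

end FineSpace

/-! ### Comparison of the Shehtman and Fine logics, and topological incompleteness -/

open FineSpace

theorem Sh_subset_FineLogic : Sh ⊆ FineLogic := fun _ h =>
  valid_of_mem_Sh shehtman_le kappa_le bb2_le h

theorem delta_zero_notMem_FineLogic : delta 0 ∉ FineLogic := by
  intro h
  have h' := valid_delta_zero_iff.1 h (singleton (FineFrame.b 0) eq_of_b_zero_le)
    (singleton (FineFrame.c 0) eq_of_c_zero_le)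
  have hd : (FineFrame.d 0 : FineSpace) ∈ (⊤ : FineAlgebra) := trivial
  rw [← h', mem_sup, isBase_singleton.mem_knot, isBase_singleton.mem_knot] at hd
  simp [coe_le_coe, FineFrame.le] at hd

theorem bot_notMem_FineLogic : Form.bot ∉ FineLogic := fun h => by
  have hd : (FineFrame.d 0 : FineSpace) ∈ (⊤ : FineAlgebra) := trivial
  rw [← h fun _ => ⊥] at hd
  exact hd

theorem isIntermediateHBLogic_Sh : IsIntermediateHBLogic Sh where
  HB_subset _ h := Derivable.mono (Set.empty_subset _) h
  closed := closedUnderRules_HBPlus _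
  consistent h := bot_notMem_FineLogic (Sh_subset_FineLogic h)

theorem finitelyAxiomatizable_Sh : FinitelyAxiomatizable Sh := ⟨_, Set.toFinite _, rfl⟩

theorem not_topologicallyComplete {L : Set Form} (hSh : Sh ⊆ L) (hF : L ⊆ FineLogic) :
    ¬ TopologicallyComplete.{u} L := fun h => by
  obtain ⟨X, _, hX, hL, hδ⟩ := h (delta 0) fun h => delta_zero_notMem_FineLogic (hF h)
  exact hδ (opValid_delta_zero hX fun ψ hψ => hL ψ (hSh hψ))

end HBLogic

theorem mainTheorem3 :
    (∀ L : Set HBLogic.Form, HBLogic.IsIntermediateHBLogic L →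
      HBLogic.Sh ⊆ L → L ⊆ HBLogic.FineLogic →
        ¬ HBLogic.TopologicallyComplete.{u} L ∧
        (∀ (X : Type u) [TopologicalSpace X] (h : HBLogic.HasCoimplication (Opens X)),
          (∀ ψ ∈ L, HBLogic.OpValid X h ψ) → HBLogic.OpValid X h (HBLogic.delta 0)) ∧
        HBLogic.delta 0 ∉ L) ∧
    (HBLogic.IsIntermediateHBLogic HBLogic.Sh ∧ HBLogic.Sh ⊆ HBLogic.FineLogic ∧
      HBLogic.FinitelyAxiomatizable HBLogic.Sh ∧
      ¬ HBLogic.TopologicallyComplete.{u} HBLogic.Sh) :=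
  ⟨fun _ _ hSh hF => ⟨HBLogic.not_topologicallyComplete hSh hF,
      fun _ _ h hL => HBLogic.opValid_delta_zero h fun ψ hψ => hL ψ (hSh hψ),
      fun h => HBLogic.delta_zero_notMem_FineLogic (hF h)⟩,
    HBLogic.isIntermediateHBLogic_Sh, HBLogic.Sh_subset_FineLogic,
    HBLogic.finitelyAxiomatizable_Sh,
    HBLogic.not_topologicallyComplete subset_rfl HBLogic.Sh_subset_FineLogic⟩
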